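/- Conventions. Modules are right modules. For a ring $A$, $\mathrm{mod}_A$ is the category of finitely generated $A$-modules and $\mathrm{ind}_A$ the class of finitely generated indecomposable $A$-modules; full subcategories are closed under isomorphisms. For $\mathcal C\subseteq\mathrm{ind}_A$, $\mathrm{add}(\mathcal C)$ consists of the direct summands of finite direct sums of modules in $\mathcal C$; $\mathrm{Gen}(N)$ consists of the quotients of modules in $\mathrm{add}(N)$. $\mathcal C$ is closed under predecessors if $X\in\mathcal C$ whenever there is a chain $X=X_0\to X_1\to\dots\to X_t=Y$ of nonzero morphisms between modules in $\mathrm{ind}_A$ with $Y\in\mathcal C$; its supporting projective is then the direct sum of all projective modules in $\mathcal C$ (one from each isomorphism class). A full subcategory of $\mathrm{mod}_A$ is abelian exact if it is abelian as a category and its inclusion is exact. A module is hereditary injective if all its quotients are injective. The points of the quiver $Q_A$ of a basic Artin algebra $A$ correspond to a complete set of primitive orthogonal idempotents $e_x$ of $A$, and there is an arrow $y\to x$ if and only if $e_yJ(A)e_x/e_yJ(A)^2e_x\neq 0$, where $J(A)$ is the Jacobson radical. Statement. Let $A$ be a basic connected Artin algebra with a ring isomorphism $A\cong\begin{pmatrix}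 C&0\\ M&B\end{pmatrix}$, where $C$, $B$ are rings and $M$ is a $B$-$C$-bimodule, let $e=\begin{pmatrix}1&0\\0&0\end{pmatrix}$, and view $C$-modules as $A$-modules through the projection $A\to C$. Let $\mathcal C\subseteq\mathrm{ind}_A$ be a full subcategory, and suppose that one of the following conditions holds: 1. $\mathcal C$ is closed under predecessors, $\mathrm{add}(\mathcal C)$ is an abelian exact subcategory of $\mathrm{mod}_A$, and $eA$ is isomorphic to the supporting projective of $\mathcal C$; 2. $M_C$ is a hereditary injective $C$-module and $\mathrm{add}(\mathcal C)=\mathrm{mod}_C$; 3. $eA(1-e)=0$, $\mathcal C=\{X\in\mathrm{ind}_A : Xe=X\}$, and every $Y\in\mathrm{ind}_A\setminus\mathcal C$ lies in $\mathrm{Gen}((1-e)A)$. Let the points of $Q_A$ be given by complete sets of primitive orthogonal idempotents of $C$ (the points of $Q_C$) and of $B$ (the points of $Q_B$). Then for every arrow $y\to x$ in $Q_A$ with $y\in (Q_B)_0$ and $x\in (Q_C)_0$, the point $x$ is a source of $Q_C$, that is, no arrow of $Q_C$ ends at $x$. -/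

import Mathlib

open CategoryTheory MulOpposite

universe u v

/-! Right modules over a ring `A` are modules over `Aᵐᵒᵖ`, with `x · a = op a • x`. -/

/-! ## Triangular matrix rings -/

/-- The set of lower triangular matrices `(c 0; m b)` with `c ∈ C`, `m ∈ M` and `b ∈ B`. -/
@[ext]
structure TriMatrix (C M B : Type u) where
  c : C
  m : M
  b : B

namespace TriMatrix

variable {C M B : Type u} [Ring C] [Ring B] [AddCommGroup M]

instance : Zero (TriMatrix C M B) := ⟨⟨0, 0, 0⟩⟩
instance : One (TriMatrix C M B) := ⟨⟨1, 0, 1⟩⟩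
instance : Add (TriMatrix C M B) := ⟨fun x y => ⟨x.c + y.c, x.m + y.m, x.b + y.b⟩⟩
instance : Neg (TriMatrix C M B) := ⟨fun x => ⟨-x.c, -x.m, -x.b⟩⟩

@[simp] lemma zero_c : (0 : TriMatrix C M B).c = 0 := rfl
@[simp] lemma zero_m : (0 : TriMatrix C M B).m = 0 := rfl
@[simp] lemma zero_b : (0 : TriMatrix C M B).b = 0 := rfl
@[simp] lemma one_c : (1 : TriMatrix C M B).c = 1 := rfl
@[simp] lemma one_m : (1 : TriMatrix C M B).m = 0 := rfl
@[simp] lemma one_b : (1 : TriMatrix C M B).b = 1 := rfl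
@[simp] lemma add_c (x y : TriMatrix C M B) : (x + y).c = x.c + y.c := rfl
@[simp] lemma add_m (x y : TriMatrix C M B) : (x + y).m = x.m + y.m := rfl
@[simp] lemma add_b (x y : TriMatrix C M B) : (x + y).b = x.b + y.b := rfl
@[simp] lemma neg_c (x : TriMatrix C M B) : (-x).c = -x.c := rfl
@[simp] lemma neg_m (x : TriMatrix C M B) : (-x).m = -x.m := rfl
@[simp] lemma neg_b (x : TriMatrix C M B) : (-x).b = -x.b := rfl
variable [Module B M] [Module Cᵐᵒᵖ M]

/-- Matrix multiplication: the lower left entry of a product is `m c' + b m'`. -/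
instance : Mul (TriMatrix C M B) :=
  ⟨fun x y => ⟨x.c * y.c, op y.c • x.m + x.b • y.m, x.b * y.b⟩⟩

@[simp] lemma mul_c (x y : TriMatrix C M B) : (x * y).c = x.c * y.c := rfl
@[simp] lemma mul_m (x y : TriMatrix C M B) :
    (x * y).m = op y.c • x.m + x.b • y.m := rfl
@[simp] lemma mul_b (x y : TriMatrix C M B) : (x * y).b = x.b * y.b := rfl

/-- The triangular matrix ring `(C 0; M B)` of a `B`-`C`-bimodule `M`. -/
instance [SMulCommClass B Cᵐᵒᵖ M] : Ring (TriMatrix C M B) where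
  add_assoc x y z := by ext <;> simp [add_assoc]
  zero_add x := by ext <;> simp
  add_zero x := by ext <;> simp
  add_comm x y := by ext <;> simp [add_comm]
  neg_add_cancel x := by ext <;> simp
  mul_assoc x y z := by
    ext <;> simp [mul_assoc, mul_smul, smul_comm, add_assoc]
  one_mul x := by ext <;> simp
  mul_one x := by ext <;> simp
  zero_mul x := by ext <;> simp
  mul_zero x := by ext <;> simp
  left_distrib x y z := by ext <;> simp [mul_add, add_smul]; abel
  right_distrib x y z := by ext <;> simp [add_mul, add_smul]; abel
  nsmul := nsmulRec
  zsmul := zsmulRec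

variable (M B) in
/-- The matrix `(c 0; 0 0)`. -/
def ofC (c : C) : TriMatrix C M B := ⟨c, 0, 0⟩

variable (C M) in
/-- The matrix `(0 0; 0 b)`. -/
def ofB (b : B) : TriMatrix C M B := ⟨0, 0, b⟩

variable (C M B) in
/-- The ring homomorphism `(C 0; M B) → C`. -/
def toC [SMulCommClass B Cᵐᵒᵖ M] : TriMatrix C M B →+* C where
  toFun := TriMatrix.c
  map_zero' := rfl
  map_one' := rfl
  map_add' _ _ := rfl
  map_mul' _ _ := rfl

end TriMatrix

/-! ## Idempotents, basic and connected rings, quivers -/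

/-- The ring `A` is nonzero and not a product of two nonzero rings. -/
def IsConnectedRing (A : Type u) [Ring A] : Prop :=
  Nontrivial A ∧ ∀ e : A, IsIdempotentElem e → (∀ a, e * a = a * e) → e = 0 ∨ e = 1

/-- A nonzero idempotent which is not the sum of two nonzero orthogonal idempotents. -/
def IsPrimitiveIdem {A : Type u} [Ring A] (e : A) : Prop :=
  e ≠ 0 ∧ IsIdempotentElem e ∧ ∀ f g : A, IsIdempotentElem f → IsIdempotentElem g →
    f * g = 0 → g * f = 0 → f + g = e → f = 0 ∨ g = 0

/-- A complete set of primitive orthogonal idempotents. -/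
def IsCompletePrimitive {A : Type u} [Ring A] {ι : Type*} [Fintype ι] (e : ι → A) : Prop :=
  CompleteOrthogonalIdempotents e ∧ ∀ i, IsPrimitiveIdem (e i)

/-- The right ideal `eA`, as a right `A`-module. -/
abbrev rightIdeal {A : Type u} [Ring A] (e : A) : Submodule Aᵐᵒᵖ A :=
  Submodule.span Aᵐᵒᵖ {e}

/-- The right module `A_A` is a direct sum of pairwise nonisomorphic indecomposable
(projective) modules `e_i A`. -/
def IsBasicRing (A : Type u) [Ring A] : Prop :=
  ∃ (n : ℕ) (e : Fin n → A), IsCompletePrimitive e ∧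
    ∀ i j, i ≠ j → IsEmpty (rightIdeal (e i) ≃ₗ[Aᵐᵒᵖ] rightIdeal (e j))

/-- The underlying directed graph of the (valued) quiver of a ring, its points being given by a
family of idempotents `e`: there is an arrow `y → x` if and only if `e_y J e_x / e_y J² e_x ≠ 0`,
where `J` is the Jacobson radical. (As `J²` is a two-sided ideal, `e_y J² e_x` consists of the
elements of `e_y J e_x` that lie in `J²`.) -/
def ringQuiver {A : Type u} [Ring A] {ι : Type*} (e : ι → A) : Digraph ι where
  Adj y x := ∃ a ∈ Ring.jacobson A, e y * a * e x ∉ Ring.jacobson A * Ring.jacobson A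

/-- A point of a directed graph is a source if no arrow ends there. -/
def IsSourcePoint {ι : Type*} (Q : Digraph ι) (x : ι) : Prop := ∀ z, ¬ Q.Adj z x

/-! ## Subcategories of the category of finitely generated right modules

Full subcategories are given by properties of right modules. -/

section ModuleClasses

variable {A : Type u} [Ring A]

/-- Finitely generated indecomposable right modules. -/
def indMod (A : Type u) [Ring A] : ObjectProperty (ModuleCat.{u} Aᵐᵒᵖ) :=
  fun X => Module.Finite Aᵐᵒᵖ X ∧ Indecomposable X

/-- The direct summands of finite direct sums of modules in `𝒞`. -/
def addClosure (𝒞 : ObjectProperty (ModuleCat.{u} Aᵐᵒᵖ)) :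
    ObjectProperty (ModuleCat.{u} Aᵐᵒᵖ) :=
  fun X => ∃ (n : ℕ) (Y : Fin n → ModuleCat.{u} Aᵐᵒᵖ), (∀ i, 𝒞 (Y i)) ∧
    ∃ Z : ModuleCat.{u} Aᵐᵒᵖ, Nonempty ((X × Z) ≃ₗ[Aᵐᵒᵖ] (∀ i, Y i))

/-- `Gen(N)`: the quotients of modules in `add(N)`. -/
def genBy (N : ModuleCat.{u} Aᵐᵒᵖ) : ObjectProperty (ModuleCat.{u} Aᵐᵒᵖ) :=
  fun X => ∃ Q : ModuleCat.{u} Aᵐᵒᵖ, addClosure (fun Y => Nonempty (Y ≅ N)) Q ∧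
    ∃ f : Q →ₗ[Aᵐᵒᵖ] X, Function.Surjective f

/-- `X` is a predecessor of `Y`: there is a path of nonzero morphisms between finitely generated
indecomposable modules from `X` to `Y`. -/
def IsPredecessor (X Y : ModuleCat.{u} Aᵐᵒᵖ) : Prop :=
  Relation.TransGen
    (fun U V : ModuleCat.{u} Aᵐᵒᵖ => indMod A U ∧ indMod A V ∧ ∃ f : U ⟶ V, f ≠ 0) X Y

/-- Every predecessor of a module in `𝒞` lies in `𝒞`. -/
def ClosedUnderPredecessors (𝒞 : ObjectProperty (ModuleCat.{u} Aᵐᵒᵖ)) : Prop :=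
  ∀ X Y, IsPredecessor X Y → 𝒞 Y → 𝒞 X

/-- The full subcategory `𝒜` is abelian as a category and its inclusion is exact. (For classes of
finitely generated modules over a right artinian ring, exactness of the inclusion into the finitely
generated modules and into all modules is the same.) -/
def IsAbelianExact (𝒜 : ObjectProperty (ModuleCat.{u} Aᵐᵒᵖ)) : Prop :=
  Nonempty (Abelian 𝒜.FullSubcategory) ∧
    Limits.PreservesFiniteLimits 𝒜.ι ∧ Limits.PreservesFiniteColimits 𝒜.ι

/-- `P` is the direct sum of all projective modules in `𝒞`, one from each isomorphism class. -/
def IsSupportingProjective (𝒞 : ObjectProperty (ModuleCat.{u} Aᵐᵒᵖ))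
    (P : ModuleCat.{u} Aᵐᵒᵖ) : Prop :=
  ∃ (n : ℕ) (Q : Fin n → ModuleCat.{u} Aᵐᵒᵖ),
    (∀ i, 𝒞 (Q i) ∧ Module.Projective Aᵐᵒᵖ (Q i)) ∧
    (∀ X, 𝒞 X → Module.Projective Aᵐᵒᵖ X → ∃! i, Nonempty (X ≅ Q i)) ∧
    Nonempty (P ≃ₗ[Aᵐᵒᵖ] (∀ i, Q i))

end ModuleClasses

/-- Every quotient of the right `R`-module `I` is injective. (By a splitting argument the same then
holds for the quotients of the finite powers of `I`.) -/
def IsHereditaryInjective (R : Type u) [Ring R] (I : Type u) [AddCommGroup I] [Module Rᵐᵒᵖ I] :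
    Prop :=
  ∀ N : Submodule Rᵐᵒᵖ I, Module.Injective Rᵐᵒᵖ (I ⧸ N)

/-! ## The three conditions

Here `A` is identified with `(C 0; M B)` through `φ`, and `𝒞` is a class of finitely generated
indecomposable right `A`-modules. -/

section Conditions

variable {A C M B : Type u} [Ring A] [Ring C] [Ring B] [AddCommGroup M] [Module B M]
  [Module Cᵐᵒᵖ M] [SMulCommClass B Cᵐᵒᵖ M]

/-- The idempotent `e = (1 0; 0 0)` of `A`. -/
def cornerIdem (φ : A ≃+* TriMatrix C M B) : A := φ.symm (TriMatrix.ofC M B 1)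

/-- The class `𝒞` is closed under predecessors, `add(𝒞)` is an abelian exact subcategory, and the
idempotent `e` with `C = eAe` is the one given by the supporting projective of `𝒞`. -/
def PredecessorCondition (φ : A ≃+* TriMatrix C M B)
    (𝒞 : ObjectProperty (ModuleCat.{u} Aᵐᵒᵖ)) : Prop :=
  ClosedUnderPredecessors 𝒞 ∧ IsAbelianExact (addClosure 𝒞) ∧
    IsSupportingProjective 𝒞 (ModuleCat.of Aᵐᵒᵖ (rightIdeal (cornerIdem φ)))

/-- The finitely generated right `C`-modules, viewed as right `A`-modules (the triples `(X, 0, 0)`),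
that is, by restriction of scalars along `A ≅ (C 0; M B) → C`. -/
def modC (φ : A ≃+* TriMatrix C M B) : ObjectProperty (ModuleCat.{u} Aᵐᵒᵖ) :=
  fun X => ∃ N : ModuleCat.{u} Cᵐᵒᵖ, Module.Finite Cᵐᵒᵖ N ∧
    Nonempty ((ModuleCat.restrictScalars
      ((TriMatrix.toC C M B).comp φ.toRingHom).op).obj N ≅ X)

/-- `M` is a hereditary injective right `C`-module, and `add(𝒞)` is `mod_C`. -/
def MatrixCondition (φ : A ≃+* TriMatrix C M B)
    (𝒞 : ObjectProperty (ModuleCat.{u} Aᵐᵒᵖ)) : Prop :=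
  IsHereditaryInjective C M ∧ addClosure 𝒞 = modC φ

/-- `eA(1-e) = 0`, the class `𝒞` consists of the indecomposable `X` with `Xe = X` (that is,
`x e = x` for all `x`), and all other indecomposable modules are generated by `(1-e)A`. -/
def IdempotentCondition (φ : A ≃+* TriMatrix C M B)
    (𝒞 : ObjectProperty (ModuleCat.{u} Aᵐᵒᵖ)) : Prop :=
  (∀ a : A, cornerIdem φ * a * (1 - cornerIdem φ) = 0) ∧
  (∀ X, 𝒞 X ↔ indMod A X ∧ ∀ x : X, op (cornerIdem φ) • x = x) ∧
  (∀ Y, indMod A Y → ¬ 𝒞 Y →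
    genBy (ModuleCat.of Aᵐᵒᵖ (rightIdeal (1 - cornerIdem φ))) Y)

/-- The points of the quiver of `A ≅ (C 0; M B)`: the idempotents of `A` given by the points of the
quivers of `C` and of `B`. -/
def triPoints (φ : A ≃+* TriMatrix C M B) {ι κ : Type*} (eC : ι → C) (eB : κ → B) : ι ⊕ κ → A :=
  Sum.elim (fun x => φ.symm (TriMatrix.ofC M B (eC x))) (fun y => φ.symm (TriMatrix.ofB C M (eB y)))

end Conditions

/-! ## Nil ideals, idempotents and the Jacobson radical -/

section Jacobson

variable {A : Type u} [Ring A]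

/-! Two arrows into `x`, one from `Q_B` and one from `Q_C`, are incompatible. Write `J` for the
radical. The arrow from `Q_C` gives `w = w e_x` in `J(C)` outside `J(C)²`, the other one an element
`n = n e_x` of `M`, and the aim is `n ∈ J(A)²`. Modulo `J²`, the element `w` generates a direct
summand of the semisimple module `J/J²`, and that summand is the simple top of `e_x A`. So some
homomorphism `J → V` takes `w` to any prescribed `s = s e_x` with `sJ = 0`
(`IsPrimitiveIdem.exists_linearMap_jacobson`). If such a map extends to a module where `w` becomes a
generator times `w`, then `s` is forced into a radical multiple and vanishes.

If `M` is hereditary injective, take `V = M/N` with `N = {m | m ∈ J(A)²}`. The map extends to `C →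
V` by injectivity, so the class of `n` lies in `VJ = 0` (`IsHereditaryInjective.mem_of_notMem`).

The other two conditions both give a dichotomy: every indecomposable is fixed by `e` or generated by
`1 - e`. Hence the trace of `1 - e` splits off every module of finite length. Applied to a pushout,
this replaces injectivity: maps from submodules of `eA` to modules generated by `1 - e` extend to
`eA` (`exists_extension_of_indMod`). Now take `V = A/(J² + eA)`, as in
`mem_jacobson_mul_jacobson_of_indMod`.

For the predecessor condition, the dichotomy is
`ClosedUnderPredecessors.fixed_or_traceSubmodule_eq_top`. Modules in `𝒞` are fixed by `e`, since no
`f_y A` can lie in `𝒞`. An indecomposable not generated by `1 - e` has a simple quotient that is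
also a quotient of `eA`; this simple module is in `𝒞` by exactness, and so is its predecessor. -/

lemma mem_jacobson_of_forall_isNilpotent {x : A} (h : ∀ y, IsNilpotent (y * x)) :
    x ∈ Ring.jacobson A := by
  rw [← Ideal.jacobson_bot, Ideal.mem_jacobson_iff]
  intro y
  obtain ⟨z, hz⟩ := (h y).isUnit_one_add.exists_left_inv
  refine ⟨z, ?_⟩
  have : z * y * x + z - 1 = z * (1 + y * x) - 1 := by noncomm_ring
  rw [this, hz, sub_self]
  exact Submodule.zero_mem _

lemma isNilpotent_of_mem_jacobson [IsArtinianRing A] {x : A} (h : x ∈ Ring.jacobson A) :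
    IsNilpotent x := by
  obtain ⟨n, hn⟩ := IsSemiprimaryRing.isNilpotent (R := A)
  refine ⟨n, ?_⟩
  have := Ideal.pow_mem_pow h n
  rwa [hn] at this

/-- Left-right symmetry of the radical, read off from nilpotency: `y * x.unop` is nilpotent because
`x * op y` is. -/
lemma unop_mem_jacobson [IsArtinianRing Aᵐᵒᵖ] {x : Aᵐᵒᵖ} (h : x ∈ Ring.jacobson Aᵐᵒᵖ) :
    x.unop ∈ Ring.jacobson A := by
  refine mem_jacobson_of_forall_isNilpotent fun y => ?_
  have h1 : x * op y ∈ Ring.jacobson Aᵐᵒᵖ := Ideal.mul_mem_right _ _ h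
  obtain ⟨n, hn⟩ := isNilpotent_of_mem_jacobson h1
  exact ⟨n, by simpa using congrArg unop hn⟩

lemma IsPrimitiveIdem.mulOpposite {e : A} (he : IsPrimitiveIdem e) : IsPrimitiveIdem (op e) := by
  obtain ⟨h0, hi, h⟩ := he
  refine ⟨by simpa using h0, congrArg MulOpposite.op hi, fun f g hf hg hfg hgf hs => ?_⟩
  have := h f.unop g.unop (congrArg unop hf) (congrArg unop hg) (congrArg unop hgf)
    (congrArg unop hfg) (congrArg unop hs)
  simpa using this

/-- A primitive idempotent `e` lies in every left ideal generated by an element of `Ae` outside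
the radical, up to the radical. -/
lemma IsPrimitiveIdem.exists_sub_mul_mem_jacobson [IsArtinianRing A] {e : A}
    (he : IsPrimitiveIdem e) {r : A} (hr : r * e = r) (hrJ : r ∉ Ring.jacobson A) :
    ∃ t, e - t * r ∈ Ring.jacobson A := by
  obtain ⟨h0, hi, h⟩ := he
  let q := Ideal.Quotient.mk (Ring.jacobson A)
  obtain ⟨f, hf, hspan⟩ := IsSemisimpleRing.ideal_eq_span_idempotent
    (Ideal.span {q r} : Ideal (A ⧸ Ring.jacobson A))
  obtain ⟨a, ha⟩ := Ideal.mem_span_singleton'.1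
    (hspan ▸ Ideal.mem_span_singleton_self f : f ∈ Ideal.span {q r})
  obtain ⟨b, hb⟩ := Ideal.mem_span_singleton'.1
    (hspan ▸ Ideal.mem_span_singleton_self (q r) : q r ∈ Ideal.span {f})
  have hqe : q r * q e = q r := by rw [← map_mul, hr]
  have hfe : f * q e = f := by rw [← ha, mul_assoc, hqe]
  have hqi : q e * q e = q e := by rw [← map_mul, hi.eq]
  -- Modulo the radical, `ef` is an idempotent orthogonal to `1 - e`. It lifts to an idempotent `g`
  -- of `eAe`, which primitivity forces to be `0` or `e`. In the first case `f = 0` and `r` is in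
  -- the radical; in the second `e` is congruent to `ef`, a left multiple of `r`.
  obtain ⟨g, hg, hgq, hg1, hg2⟩ := exists_isIdempotentElem_mul_eq_zero_of_ker_isNilpotent q
    (fun x hx => isNilpotent_of_mem_jacobson (by
      rwa [RingHom.mem_ker, Ideal.Quotient.eq_zero_iff_mem] at hx))
    (q e * f) (Ideal.Quotient.mk_surjective _)
    (by rw [IsIdempotentElem, mul_assoc, ← mul_assoc f, hfe, hf.eq])
    (1 - e) hi.one_sub
    (by rw [map_sub, map_one, mul_sub, mul_one, mul_assoc, hfe, sub_self])
    (by rw [map_sub, map_one, sub_mul, one_mul, ← mul_assoc, hqi, sub_self])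
  have hge : g * e = g := by simpa [mul_sub, sub_eq_zero, eq_comm] using hg1
  have heg : e * g = g := by simpa [sub_mul, sub_eq_zero, eq_comm] using hg2
  rcases h g (e - g) hg (by
      rw [IsIdempotentElem, mul_sub, sub_mul, sub_mul, hi.eq, hge, heg, hg.eq]; abel)
      (by rw [mul_sub, hge, hg.eq, sub_self]) (by rw [sub_mul, heg, hg.eq, sub_self])
      (by abel) with h' | h'
  · refine absurd ?_ hrJ
    rw [← Ideal.Quotient.eq_zero_iff_mem]
    have : f = 0 := by
      rw [← hf.eq]
      nth_rewrite 1 [← hfe]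
      rw [mul_assoc, ← hgq, h', map_zero, mul_zero]
    change q r = 0
    rw [← hb, this, mul_zero]
  · obtain ⟨a', rfl⟩ := Ideal.Quotient.mk_surjective a
    refine ⟨e * a', ?_⟩
    rw [← Ideal.Quotient.eq_zero_iff_mem]
    change q (e - e * a' * r) = 0
    rw [map_sub, map_mul, map_mul, mul_assoc, show q a' * q r = f from ha, ← hgq,
      ← sub_eq_zero.1 h', sub_self]

/-- Over an artinian ring, a module annihilated by the radical is semisimple. -/
lemma isSemisimpleModule_of_jacobson_smul [IsArtinianRing A] {P : Type*} [AddCommGroup P]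
    [Module A P] (h : ∀ r ∈ Ring.jacobson A, ∀ p : P, r • p = 0) : IsSemisimpleModule A P := by
  have h' : Module.IsTorsionBySet A P (Ring.jacobson A) := fun p r => h _ r.2 p
  let _ := h'.module
  exact (h'.semilinearMap.isSemisimpleModule_iff_of_bijective Function.bijective_id).2
    inferInstance

/-- Let `e` be a primitive idempotent. A nonzero element `w = ew` of a module annihilated by the
radical can be mapped to every element `s = es` of a module that the radical annihilates. -/
lemma IsPrimitiveIdem.exists_linearMap [IsArtinianRing A] {e : A} (he : IsPrimitiveIdem e)
    {P V : Type*} [AddCommGroup P] [Module A P] [AddCommGroup V] [Module A V]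
    (hP : ∀ r ∈ Ring.jacobson A, ∀ p : P, r • p = 0) {w : P} (hw : e • w = w) (hw0 : w ≠ 0)
    {s : V} (hs : e • s = s) (hsJ : ∀ r ∈ Ring.jacobson A, r • s = 0) :
    ∃ f : P →ₗ[A] V, f w = s := by
  have hle : LinearMap.ker (LinearMap.toSpanSingleton A P w) ≤
      LinearMap.ker (LinearMap.toSpanSingleton A V s) := by
    intro r hr
    simp only [LinearMap.mem_ker, LinearMap.toSpanSingleton_apply] at hr ⊢
    by_cases hJ : r * e ∈ Ring.jacobson A
    · rw [← hs, ← mul_smul, hsJ _ hJ]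
    -- Here `e` is congruent to `t r e` modulo the radical, so `w = t r w = 0`.
    · obtain ⟨t, ht⟩ := he.exists_sub_mul_mem_jacobson (by rw [mul_assoc, he.2.1.eq]) hJ
      refine absurd ?_ hw0
      have := hP _ ht w
      rwa [sub_smul, hw, mul_smul, mul_smul, hw, hr, smul_zero, sub_zero] at this
  -- By semisimplicity `Aw` is a direct summand, so `w ↦ s` needs to be defined only on `Aw`, where
  -- the inclusion of annihilators suffices.
  have := isSemisimpleModule_of_jacobson_smul hP
  let ρ := LinearMap.toSpanSingleton A P w
  obtain ⟨K, hK⟩ := exists_isCompl (LinearMap.range ρ)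
  let g : LinearMap.range ρ →ₗ[A] V :=
    (Submodule.liftQ _ (LinearMap.toSpanSingleton A V s) hle) ∘ₗ
      ρ.quotKerEquivRange.symm.toLinearMap
  refine ⟨g ∘ₗ Submodule.projectionOnto _ _ hK, ?_⟩
  have h1 : Submodule.projectionOnto _ _ hK w = ρ.quotKerEquivRange (Submodule.Quotient.mk 1) := by
    have hwr : w = ((ρ.quotKerEquivRange (Submodule.Quotient.mk 1) : LinearMap.range ρ) : P) := by
      rw [LinearMap.quotKerEquivRange_apply_mk]; simp [ρ]
    conv_lhs => rw [hwr]
    rw [Submodule.projectionOnto_apply_left]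
  rw [LinearMap.comp_apply, h1]
  change (Submodule.liftQ _ (LinearMap.toSpanSingleton A V s) hle)
    (ρ.quotKerEquivRange.symm (ρ.quotKerEquivRange (Submodule.Quotient.mk 1))) = s
  rw [LinearEquiv.symm_apply_apply]
  simp

/-- A two-sided ideal, as a right submodule. -/
def Ideal.toRightSubmodule (I : Ideal A) [I.IsTwoSided] : Submodule Aᵐᵒᵖ A where
  carrier := I
  add_mem' := I.add_mem
  zero_mem' := I.zero_mem
  smul_mem' r x hx := by
    change x * r.unop ∈ I
    exact I.mul_mem_right _ hx

@[simp] lemma Ideal.mem_toRightSubmodule (I : Ideal A) [I.IsTwoSided] {x : A} :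
    x ∈ I.toRightSubmodule ↔ x ∈ I := Iff.rfl

/-- Let `e` be a primitive idempotent. An element `w = we` of `J ∖ J²` can be mapped to every
element `s = se` with `sJ = 0` of a right module. -/
lemma IsPrimitiveIdem.exists_linearMap_jacobson [IsArtinianRing Aᵐᵒᵖ] {e : A}
    (he : IsPrimitiveIdem e) {V : Type*} [AddCommGroup V] [Module Aᵐᵒᵖ V] {w : A}
    (hwJ : w ∈ Ring.jacobson A) (hwJ2 : w ∉ Ring.jacobson A * Ring.jacobson A) (hw : w * e = w)
    {s : V} (hs : op e • s = s) (hsJ : ∀ r ∈ Ring.jacobson A, op r • s = 0) :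
    ∃ f : (Ring.jacobson A).toRightSubmodule →ₗ[Aᵐᵒᵖ] V, f ⟨w, hwJ⟩ = s := by
  let K := (Ring.jacobson A * Ring.jacobson A).toRightSubmodule.comap
    (Ring.jacobson A).toRightSubmodule.subtype
  have hKJ : ∀ r ∈ Ring.jacobson Aᵐᵒᵖ,
      ∀ p : (Ring.jacobson A).toRightSubmodule ⧸ K, r • p = 0 := by
    intro r hr p
    obtain ⟨p, rfl⟩ := K.mkQ_surjective p
    rw [← map_smul, Submodule.mkQ_apply, Submodule.Quotient.mk_eq_zero]
    exact Ideal.mul_mem_mul p.2 (unop_mem_jacobson hr)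
  have hw' : op e • K.mkQ ⟨w, hwJ⟩ = K.mkQ ⟨w, hwJ⟩ := by
    rw [← map_smul]
    exact congrArg _ (Subtype.ext hw)
  have hw0 : K.mkQ ⟨w, hwJ⟩ ≠ 0 := by
    rw [Submodule.mkQ_apply, Ne, Submodule.Quotient.mk_eq_zero]
    exact hwJ2
  obtain ⟨f, hf⟩ := he.mulOpposite.exists_linearMap hKJ hw' hw0 hs
    fun r hr => hsJ _ (unop_mem_jacobson hr)
  exact ⟨f ∘ₗ K.mkQ, hf⟩

end Jacobson

/-! ## Traces of idempotents and indecomposable modules -/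

section Trace

variable {A : Type u} [Ring A]

lemma indMod_of_forall_isCompl (Y : ModuleCat.{u} Aᵐᵒᵖ) [Module.Finite Aᵐᵒᵖ Y] [Nontrivial Y]
    (h : ∀ U W : Submodule Aᵐᵒᵖ Y, IsCompl U W → U = ⊥ ∨ W = ⊥) : indMod A Y := by
  refine ⟨inferInstance, ?_, fun P Q i => ?_⟩
  · rw [ModuleCat.isZero_iff_subsingleton]
    exact not_subsingleton _
  · let i' : Y ≃ₗ[Aᵐᵒᵖ] (P × Q) := (i ≪≫ ModuleCat.biprodIsoProd P Q).toLinearEquiv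
    have hc := (LinearMap.isCompl_range_inl_inr (R := Aᵐᵒᵖ) (M := P) (M₂ := Q)).map
      (Submodule.orderIsoMapComap i'.symm)
    simp only [ModuleCat.isZero_iff_subsingleton]
    refine (h _ _ hc).imp (fun h0 => ⟨fun a b => ?_⟩) (fun h0 => ⟨fun a b => ?_⟩)
    · have h1 : LinearMap.range (LinearMap.inl Aᵐᵒᵖ P Q) = ⊥ :=
        (map_eq_bot_iff (Submodule.orderIsoMapComap i'.symm)).1 h0
      have (c : P) : c = 0 := congrArg Prod.fst
        (LinearMap.congr_fun (LinearMap.range_eq_bot.1 h1) c)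
      rw [this a, this b]
    · have h1 : LinearMap.range (LinearMap.inr Aᵐᵒᵖ P Q) = ⊥ :=
        (map_eq_bot_iff (Submodule.orderIsoMapComap i'.symm)).1 h0
      have (c : Q) : c = 0 := congrArg Prod.snd
        (LinearMap.congr_fun (LinearMap.range_eq_bot.1 h1) c)
      rw [this a, this b]

/-- The submodule `XdA` of a right module `X`. -/
def traceSubmodule (d : A) (X : Type*) [AddCommGroup X] [Module Aᵐᵒᵖ X] : Submodule Aᵐᵒᵖ X :=
  Submodule.span Aᵐᵒᵖ (Set.range fun x : X => op d • x)

lemma op_smul_mem_traceSubmodule (d : A) {X : Type*} [AddCommGroup X] [Module Aᵐᵒᵖ X] (x : X) :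
    op d • x ∈ traceSubmodule d X := Submodule.subset_span (Set.mem_range_self x)

lemma map_mem_traceSubmodule (d : A) {X Y : Type*} [AddCommGroup X] [Module Aᵐᵒᵖ X]
    [AddCommGroup Y] [Module Aᵐᵒᵖ Y] (f : X →ₗ[Aᵐᵒᵖ] Y) {x : X} (hx : x ∈ traceSubmodule d X) :
    f x ∈ traceSubmodule d Y := by
  suffices traceSubmodule d X ≤ (traceSubmodule d Y).comap f from this hx
  refine Submodule.span_le.2 ?_
  rintro _ ⟨x, rfl⟩
  change f (op d • x) ∈ traceSubmodule d Y
  rw [map_smul]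
  exact op_smul_mem_traceSubmodule d _

lemma traceSubmodule_eq_top_of_surjective (d : A) {X Y : Type*} [AddCommGroup X] [Module Aᵐᵒᵖ X]
    [AddCommGroup Y] [Module Aᵐᵒᵖ Y] (f : X →ₗ[Aᵐᵒᵖ] Y) (hf : Function.Surjective f)
    (h : traceSubmodule d X = ⊤) : traceSubmodule d Y = ⊤ := by
  refine eq_top_iff.2 fun y _ => ?_
  obtain ⟨x, rfl⟩ := hf y
  exact map_mem_traceSubmodule d f (h ▸ Submodule.mem_top)

lemma traceSubmodule_pi_eq_top (d : A) {ι : Type*} [Finite ι] {Y : ι → Type*}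
    [∀ i, AddCommGroup (Y i)] [∀ i, Module Aᵐᵒᵖ (Y i)] (h : ∀ i, traceSubmodule d (Y i) = ⊤) :
    traceSubmodule d (∀ i, Y i) = ⊤ := by
  classical
  have := Fintype.ofFinite ι
  refine eq_top_iff.2 fun y _ => ?_
  rw [← Finset.univ_sum_single y]
  exact Submodule.sum_mem _ fun i _ =>
    map_mem_traceSubmodule d (LinearMap.single Aᵐᵒᵖ Y i) (h i ▸ Submodule.mem_top)

lemma traceSubmodule_rightIdeal {d : A} (hd : IsIdempotentElem d) :
    traceSubmodule d (rightIdeal d) = ⊤ := by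
  refine eq_top_iff.2 fun y _ => ?_
  obtain ⟨y, hy⟩ := y
  obtain ⟨a, rfl⟩ := Submodule.mem_span_singleton.1 hy
  let g : rightIdeal d := ⟨d, Submodule.mem_span_singleton_self d⟩
  have hg : op d • g = g := Subtype.ext hd.eq
  have : (⟨a • d, hy⟩ : rightIdeal d) = a • op d • g := by rw [hg]; rfl
  rw [this]
  exact Submodule.smul_mem _ _ (op_smul_mem_traceSubmodule d g)

/-- `dA` is generated by `d`, and this property passes to finite direct sums and to quotients; a
direct summand is also a quotient. -/
lemma traceSubmodule_eq_top_of_genBy {d : A} (hd : IsIdempotentElem d)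
    {Y : ModuleCat.{u} Aᵐᵒᵖ} (h : genBy (ModuleCat.of Aᵐᵒᵖ (rightIdeal d)) Y) :
    traceSubmodule d Y = ⊤ := by
  obtain ⟨Q, ⟨n, N, hN, Z, ⟨i⟩⟩, f, hf⟩ := h
  refine traceSubmodule_eq_top_of_surjective d
    ((f ∘ₗ LinearMap.fst Aᵐᵒᵖ Q Z) ∘ₗ i.symm.toLinearMap)
    ((hf.comp Prod.fst_surjective).comp i.symm.surjective)
    (traceSubmodule_pi_eq_top d fun j => ?_)
  obtain ⟨k⟩ := hN j
  exact traceSubmodule_eq_top_of_surjective d k.toLinearEquiv.symm.toLinearMap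
    k.toLinearEquiv.symm.surjective (traceSubmodule_rightIdeal hd)

/-- Every submodule of a module of finite length is the direct sum of a submodule fixed by `e` and
a submodule of the trace of `1 - e`, if this holds for indecomposable modules. -/
lemma exists_disjoint_sup_eq_of_indMod (e : A)
    (H : ∀ Y, indMod A Y → (∀ y : Y, op e • y = y) ∨ traceSubmodule (1 - e) Y = ⊤)
    {X : Type u} [AddCommGroup X] [Module Aᵐᵒᵖ X] [IsNoetherian Aᵐᵒᵖ X] [IsArtinian Aᵐᵒᵖ X]
    (N : Submodule Aᵐᵒᵖ X) :
    ∃ U W : Submodule Aᵐᵒᵖ X, Disjoint U W ∧ U ⊔ W = N ∧ (∀ x ∈ U, op e • x = x) ∧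
      W ≤ traceSubmodule (1 - e) X := by
  induction N using WellFoundedLT.induction with
  | ind N ih =>
  rcases eq_or_ne N ⊥ with rfl | hN
  · exact ⟨⊥, ⊥, disjoint_bot_left, sup_bot_eq _, by simp, bot_le⟩
  have : Nontrivial (ModuleCat.of Aᵐᵒᵖ N) := (Submodule.nontrivial_iff_ne_bot).2 hN
  have : Module.Finite Aᵐᵒᵖ (ModuleCat.of Aᵐᵒᵖ N) := inferInstanceAs (Module.Finite Aᵐᵒᵖ N)
  by_cases hi : ∀ U W : Submodule Aᵐᵒᵖ (ModuleCat.of Aᵐᵒᵖ N), IsCompl U W → U = ⊥ ∨ W = ⊥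
  · rcases H _ (indMod_of_forall_isCompl _ hi) with h | h
    · exact ⟨N, ⊥, disjoint_bot_right, sup_bot_eq _,
        fun x hx => congrArg Subtype.val (h ⟨x, hx⟩), bot_le⟩
    · refine ⟨⊥, N, disjoint_bot_left, bot_sup_eq _, by simp, fun x hx => ?_⟩
      exact map_mem_traceSubmodule (1 - e) N.subtype (x := ⟨x, hx⟩)
        (by
          have : (⟨x, hx⟩ : N) ∈ (⊤ : Submodule Aᵐᵒᵖ N) := Submodule.mem_top
          rwa [← show traceSubmodule (1 - e) N = ⊤ from h] at this)
  · push Not at hi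
    obtain ⟨P, Q, hPQ, hP, hQ⟩ := hi
    change Submodule Aᵐᵒᵖ N at P Q
    -- Both summands are proper in `N`, so the induction hypothesis applies to them.
    have key : ∀ P Q : Submodule Aᵐᵒᵖ N, IsCompl P Q → Q ≠ ⊥ → P.map N.subtype < N := by
      intro P Q hPQ hQ
      refine lt_of_le_of_ne (Submodule.map_subtype_le _ _) fun h => hQ ?_
      have : P = ⊤ := by
        apply Submodule.map_injective_of_injective N.injective_subtype
        rw [h, Submodule.map_subtype_top]
      rw [this] at hPQ
      simpa using hPQ.inf_eq_bot
    have hd : Disjoint (P.map N.subtype) (Q.map N.subtype) :=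
      (Submodule.disjoint_map N.injective_subtype hPQ.disjoint)
    have hs : P.map N.subtype ⊔ Q.map N.subtype = N := by
      rw [← Submodule.map_sup, hPQ.sup_eq_top, Submodule.map_subtype_top]
    obtain ⟨U₁, W₁, d₁, s₁, h₁, t₁⟩ := ih _ (key P Q hPQ hQ)
    obtain ⟨U₂, W₂, d₂, s₂, h₂, t₂⟩ := ih _ (key Q P hPQ.symm hP)
    refine ⟨U₁ ⊔ U₂, W₁ ⊔ W₂, ?_, ?_, ?_, sup_le t₁ t₂⟩
    · rw [Submodule.disjoint_def] at d₁ d₂ hd ⊢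
      intro x hx hx'
      obtain ⟨a, ha, b, hb, rfl⟩ := Submodule.mem_sup.1 hx
      obtain ⟨c, hc, d, hd', hab⟩ := Submodule.mem_sup.1 hx'
      -- From `a + b = c + d`, the element `a - c = d - b` lies in both summands, hence is zero;
      -- then `a` and `b` vanish by disjointness inside each summand.
      have hP' : a - c ∈ P.map N.subtype := s₁ ▸ Submodule.sub_mem _
        (Submodule.mem_sup_left ha) (Submodule.mem_sup_right hc)
      have hQ' : d - b ∈ Q.map N.subtype := s₂ ▸ Submodule.sub_mem _
        (Submodule.mem_sup_right hd') (Submodule.mem_sup_left hb)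
      have he : a - c = d - b := by
        rw [sub_eq_sub_iff_add_eq_add, ← hab, add_comm]
      have h0 := hd _ hP' (he ▸ hQ')
      have hac := sub_eq_zero.1 h0
      have hdb := sub_eq_zero.1 (he ▸ h0)
      rw [d₁ a ha (hac ▸ hc), d₂ b hb (hdb ▸ hd'), add_zero]
    · rw [← hs, ← s₁, ← s₂, sup_sup_sup_comm]
    · intro x hx
      obtain ⟨a, ha, b, hb, rfl⟩ := Submodule.mem_sup.1 hx
      rw [smul_add, h₁ a ha, h₂ b hb]

/-- In `X = U ⊕ W` the idempotent `1 - e` kills `U`, so it sends `X` into `W`, and the trace of `1 -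
e` is exactly `W`. -/
lemma exists_isCompl_traceSubmodule (e : A)
    (H : ∀ Y, indMod A Y → (∀ y : Y, op e • y = y) ∨ traceSubmodule (1 - e) Y = ⊤)
    {X : Type u} [AddCommGroup X] [Module Aᵐᵒᵖ X] [IsNoetherian Aᵐᵒᵖ X] [IsArtinian Aᵐᵒᵖ X] :
    ∃ U : Submodule Aᵐᵒᵖ X, IsCompl (traceSubmodule (1 - e) X) U := by
  obtain ⟨U, W, hd, hs, hU, hW⟩ := exists_disjoint_sup_eq_of_indMod e H (⊤ : Submodule Aᵐᵒᵖ X)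
  refine ⟨U, ?_⟩
  have : traceSubmodule (1 - e) X = W := by
    refine le_antisymm (Submodule.span_le.2 ?_) hW
    rintro _ ⟨x, rfl⟩
    obtain ⟨a, ha, b, hb, rfl⟩ := Submodule.mem_sup.1 (hs ▸ Submodule.mem_top : x ∈ U ⊔ W)
    have h0 : op (1 - e) • a = 0 := by rw [MulOpposite.op_sub, sub_smul, hU a ha, MulOpposite.op_one,
       one_smul, sub_self]
    change op (1 - e) • (a + b) ∈ W
    rw [smul_add, h0, zero_add]
    exact W.smul_mem _ hb
  rw [this]
  exact ⟨hd.symm, codisjoint_iff.2 (sup_comm U W ▸ hs)⟩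

/-- Homomorphisms from a submodule of a module fixed by `e` to a module generated by `1 - e`
extend, if every indecomposable module is fixed by `e` or generated by `1 - e`. -/
lemma exists_extension_of_indMod (e : A)
    (H : ∀ Y, indMod A Y → (∀ y : Y, op e • y = y) ∨ traceSubmodule (1 - e) Y = ⊤)
    {P V : Type u} [AddCommGroup P] [Module Aᵐᵒᵖ P] [IsNoetherian Aᵐᵒᵖ P] [IsArtinian Aᵐᵒᵖ P]
    [AddCommGroup V] [Module Aᵐᵒᵖ V] [IsNoetherian Aᵐᵒᵖ V] [IsArtinian Aᵐᵒᵖ V]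
    (hP : ∀ p : P, op e • p = p) (hV : traceSubmodule (1 - e) V = ⊤)
    (I : Submodule Aᵐᵒᵖ P) (f : I →ₗ[Aᵐᵒᵖ] V) :
    ∃ g : P →ₗ[Aᵐᵒᵖ] V, ∀ i : I, g i = f i := by
  -- The quotient by `K` is the pushout of `f` and the inclusion of `I` in `P`. As `1 - e` kills
  -- `P`, its trace there is the image of `V`; a complement yields a retraction onto `V`, whose
  -- restriction to `P` extends `f`.
  let K : Submodule Aᵐᵒᵖ (P × V) := LinearMap.range (I.subtype.prod (-f))
  let inP : P →ₗ[Aᵐᵒᵖ] (P × V) ⧸ K := K.mkQ ∘ₗ LinearMap.inl Aᵐᵒᵖ P V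
  let inV : V →ₗ[Aᵐᵒᵖ] (P × V) ⧸ K := K.mkQ ∘ₗ LinearMap.inr Aᵐᵒᵖ P V
  have hinV : Function.Injective inV := by
    rw [← LinearMap.ker_eq_bot, LinearMap.ker_eq_bot']
    intro v hv
    obtain ⟨i, hi⟩ := (Submodule.Quotient.mk_eq_zero _).1 hv
    have h1 : (i : P) = 0 := congrArg Prod.fst hi
    have h2 : -f i = v := congrArg Prod.snd hi
    rw [← h2, show i = 0 from Subtype.ext h1, map_zero, neg_zero]
  have htr : traceSubmodule (1 - e) ((P × V) ⧸ K) = LinearMap.range inV := by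
    apply le_antisymm
    · refine Submodule.span_le.2 ?_
      rintro _ ⟨x, rfl⟩
      obtain ⟨⟨p, v⟩, rfl⟩ := K.mkQ_surjective x
      refine ⟨op (1 - e) • v, ?_⟩
      change K.mkQ (0, op (1 - e) • v) = op (1 - e) • K.mkQ (p, v)
      rw [← map_smul, Prod.smul_mk]
      congr 2
      rw [MulOpposite.op_sub, sub_smul, hP, MulOpposite.op_one, one_smul, sub_self]
    · rintro _ ⟨v, rfl⟩
      exact map_mem_traceSubmodule _ inV (hV ▸ Submodule.mem_top)
  obtain ⟨U, hU⟩ := exists_isCompl_traceSubmodule e H (X := (P × V) ⧸ K)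
  rw [htr] at hU
  let ρ : (P × V) ⧸ K →ₗ[Aᵐᵒᵖ] V :=
    (LinearEquiv.ofInjective inV hinV).symm.toLinearMap ∘ₗ Submodule.projectionOnto _ _ hU
  have hρ (v : V) : ρ (inV v) = v := by
    have : inV v = ((LinearEquiv.ofInjective inV hinV v : LinearMap.range inV) :
      (P × V) ⧸ K) := rfl
    rw [this, LinearMap.comp_apply, Submodule.projectionOnto_apply_left]
    exact LinearEquiv.symm_apply_apply _ _
  refine ⟨ρ ∘ₗ inP, fun i => ?_⟩
  have : inP i = inV (f i) := by
    rw [← sub_eq_zero]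
    change K.mkQ (i, 0) - K.mkQ (0, f i) = 0
    rw [← map_sub, Submodule.mkQ_apply, Submodule.Quotient.mk_eq_zero]
    exact ⟨i, by simp⟩
  rw [LinearMap.comp_apply, this, hρ]

end Trace

/-! ## Classes closed under predecessors -/

section Predecessors

variable {A : Type u} [Ring A]

lemma mem_rightIdeal {e : A} (he : IsIdempotentElem e) {a : A} :
    a ∈ rightIdeal e ↔ e * a = a := by
  rw [Submodule.mem_span_singleton]
  constructor
  · rintro ⟨r, rfl⟩
    rw [mul_smul_comm, he.eq]
  · intro h
    exact ⟨op a, h⟩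

/-- The homomorphism `A → X` of right modules given by an element of `X`. -/
def evalAt {X : Type*} [AddCommGroup X] [Module Aᵐᵒᵖ X] (x : X) : A →ₗ[Aᵐᵒᵖ] X where
  toFun a := op a • x
  map_add' a b := by rw [MulOpposite.op_add, add_smul]
  map_smul' r a := by
    rw [RingHom.id_apply, ← mul_smul]
    rfl

@[simp] lemma evalAt_apply {X : Type*} [AddCommGroup X] [Module Aᵐᵒᵖ X] (x : X) (a : A) :
    evalAt x a = op a • x := rfl

lemma projective_rightIdeal {e : A} (he : IsIdempotentElem e) :
    Module.Projective Aᵐᵒᵖ (rightIdeal e) := by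
  let s : rightIdeal e →ₗ[Aᵐᵒᵖ] Aᵐᵒᵖ :=
    { toFun := fun a => op a.1
      map_add' := fun _ _ => rfl
      map_smul' := fun _ _ => rfl }
  refine Module.Projective.of_split s
    (LinearMap.toSpanSingleton Aᵐᵒᵖ _ ⟨e, Submodule.mem_span_singleton_self e⟩) ?_
  ext a
  exact (mem_rightIdeal he).1 a.2

/-- A decomposition `eA = U ⊕ W` writes `e = u + w` with orthogonal idempotents; primitivity kills
one of them, and then `e` generates inside the other summand. -/
lemma IsPrimitiveIdem.indMod_rightIdeal {e : A} (he : IsPrimitiveIdem e) :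
    indMod A (ModuleCat.of Aᵐᵒᵖ (rightIdeal e)) := by
  obtain ⟨h0, hi, h⟩ := he
  let g : rightIdeal e := ⟨e, Submodule.mem_span_singleton_self e⟩
  have : Nontrivial (ModuleCat.of Aᵐᵒᵖ (rightIdeal e)) :=
    ⟨g, 0, fun h' => h0 (congrArg Subtype.val h')⟩
  have : Module.Finite Aᵐᵒᵖ (ModuleCat.of Aᵐᵒᵖ (rightIdeal e)) :=
    Module.Finite.span_singleton Aᵐᵒᵖ e
  refine indMod_of_forall_isCompl _ fun U W hUW => ?_
  change Submodule Aᵐᵒᵖ (rightIdeal e) at U W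
  have key : ∀ U W : Submodule Aᵐᵒᵖ (rightIdeal e), IsCompl U W → ∀ u ∈ U, ∀ w ∈ W,
      u + w = g → u.1 * u.1 = u.1 ∧ w.1 * u.1 = 0 := by
    intro U W hUW u hu w hw huw
    have h1 : u.1 + w.1 = e := congrArg Subtype.val huw
    -- The identity `eu = u` reads `u - uu = wu`, with left side in `U` and right side in `W`; so
    -- both sides are zero.
    have h2 : u - op u.1 • u = op u.1 • w := by
      apply Subtype.ext
      change u.1 - u.1 * u.1 = w.1 * u.1
      rw [sub_eq_iff_eq_add', ← add_mul, h1, (mem_rightIdeal hi).1 u.2]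
    have h3 : u - op u.1 • u = 0 := Submodule.disjoint_def.1 hUW.disjoint _
      (U.sub_mem hu (U.smul_mem _ hu)) (h2 ▸ W.smul_mem _ hw)
    exact ⟨(sub_eq_zero.1 (congrArg Subtype.val h3)).symm,
      congrArg Subtype.val (h2.symm.trans h3)⟩
  have top : ∀ U W : Submodule Aᵐᵒᵖ (rightIdeal e), IsCompl U W → g ∈ W → U = ⊥ := by
    intro U W hUW hg
    have : W = ⊤ := by
      refine eq_top_iff.2 fun x _ => ?_
      have : x = op x.1 • g := Subtype.ext ((mem_rightIdeal hi).1 x.2).symm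
      rw [this]
      exact W.smul_mem _ hg
    subst this
    simpa using hUW.inf_eq_bot
  obtain ⟨u, hu, w, hw, huw⟩ := Submodule.mem_sup.1
    (hUW.sup_eq_top ▸ Submodule.mem_top : g ∈ U ⊔ W)
  obtain ⟨huu, hwu⟩ := key U W hUW u hu w hw huw
  obtain ⟨hww, huw'⟩ := key W U hUW.symm w hw u hu (by rw [add_comm, huw])
  refine (h u.1 w.1 huu hww huw' hwu (congrArg Subtype.val huw)).imp (fun h' => ?_) fun h' => ?_
  · refine top U W hUW ?_
    rwa [← huw, show u = 0 from Subtype.ext h', zero_add]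
  · refine top W U hUW.symm ?_
    rwa [← huw, show w = 0 from Subtype.ext h', add_zero]

/-- An abelian exact subcategory is closed under cokernels. -/
lemma IsAbelianExact.prop_of_surjective {𝒜 : ObjectProperty (ModuleCat.{u} Aᵐᵒᵖ)}
    [𝒜.IsClosedUnderIsomorphisms] (h : IsAbelianExact 𝒜) {X Y Q : ModuleCat.{u} Aᵐᵒᵖ}
    (hX : 𝒜 X) (hY : 𝒜 Y) (f : X →ₗ[Aᵐᵒᵖ] Y) (p : Y →ₗ[Aᵐᵒᵖ] Q) (hp : Function.Surjective p)
    (hker : LinearMap.ker p = LinearMap.range f) : 𝒜 Q := by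
  obtain ⟨⟨_⟩, _, hcol⟩ := h
  let X' : 𝒜.FullSubcategory := ⟨X, hX⟩
  let Y' : 𝒜.FullSubcategory := ⟨Y, hY⟩
  let f' : X' ⟶ Y' := ObjectProperty.homMk (ModuleCat.ofHom f)
  -- The cokernel is taken as the coequalizer of `f` with the zero linear map, so nothing is needed
  -- about how the additive structure of the abelian category relates to that of modules.
  let z' : X' ⟶ Y' := ObjectProperty.homMk 0
  have hl := Limits.isColimitCoforkMapOfIsColimit 𝒜.ι _
    (Limits.coequalizerIsCoequalizer f' z')
  let q : Y ⟶ (Limits.coequalizer f' z').obj := (Limits.coequalizer.π f' z').hom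
  have hfp : ModuleCat.ofHom f ≫ ModuleCat.ofHom p = (0 : X ⟶ Y) ≫ ModuleCat.ofHom p := by
    rw [Limits.zero_comp, ← ModuleCat.ofHom_comp]
    ext x
    have : f x ∈ LinearMap.ker p := hker ▸ LinearMap.mem_range_self f x
    exact this
  obtain ⟨l, hl1⟩ := Limits.Cofork.IsColimit.desc' hl (ModuleCat.ofHom p) hfp
  have hl1 : q ≫ l = ModuleCat.ofHom p := hl1
  have hq0 : ModuleCat.ofHom f ≫ q = 0 := by
    have := congrArg (fun t => t.hom) (Limits.coequalizer.condition f' z')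
    have h2 : ModuleCat.ofHom f ≫ q = (0 : X ⟶ Y) ≫ q := this
    rw [h2, Limits.zero_comp]
  have hkq : LinearMap.ker p ≤ LinearMap.ker q.hom := by
    rw [hker]
    rintro _ ⟨x, rfl⟩
    exact LinearMap.congr_fun (congrArg ModuleCat.Hom.hom hq0) x
  let pe := p.quotKerEquivOfSurjective hp
  let k : Q →ₗ[Aᵐᵒᵖ] (Limits.coequalizer f' z').obj :=
    (LinearMap.ker p).liftQ q.hom hkq ∘ₗ pe.symm.toLinearMap
  have hk : ModuleCat.ofHom p ≫ ModuleCat.ofHom k = q := by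
    ext y
    have : pe.symm (p y) = Submodule.Quotient.mk y := by
      rw [LinearEquiv.symm_apply_eq]
      rfl
    change (LinearMap.ker p).liftQ q.hom hkq (pe.symm (p y)) = q.hom y
    rw [this]
    rfl
  have : Epi (ModuleCat.ofHom p) := (ModuleCat.epi_iff_surjective _).2 hp
  refine 𝒜.prop_of_iso (X := (Limits.coequalizer f' z').obj)
    ⟨l, ModuleCat.ofHom k, ?_, ?_⟩ (Limits.coequalizer f' z').property
  · refine Limits.Cofork.IsColimit.hom_ext hl ?_
    change q ≫ l ≫ ModuleCat.ofHom k = q ≫ 𝟙 _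
    rw [← Category.assoc, hl1, hk, Category.comp_id]
  · rw [← cancel_epi (ModuleCat.ofHom p), ← Category.assoc, hk, hl1, Category.comp_id]

instance (𝒞 : ObjectProperty (ModuleCat.{u} Aᵐᵒᵖ)) :
    (addClosure 𝒞).IsClosedUnderIsomorphisms where
  of_iso := by
    rintro X X' i ⟨n, Y, hY, Z, ⟨k⟩⟩
    exact ⟨n, Y, hY, Z, ⟨(i.symm.toLinearEquiv.prodCongr (LinearEquiv.refl _ _)).trans k⟩⟩

lemma IsSupportingProjective.addClosure {𝒞 : ObjectProperty (ModuleCat.{u} Aᵐᵒᵖ)}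
    {P : ModuleCat.{u} Aᵐᵒᵖ} (h : IsSupportingProjective 𝒞 P) : addClosure 𝒞 P := by
  obtain ⟨n, Q, hQ, -, ⟨k⟩⟩ := h
  exact ⟨n, Q, fun i => (hQ i).1, ModuleCat.of Aᵐᵒᵖ PUnit.{u + 1},
    ⟨(LinearEquiv.prodUnique (R := Aᵐᵒᵖ) (M := P) (M₂ := PUnit.{u + 1})).trans k⟩⟩

lemma IsSupportingProjective.exists_surjective {𝒞 : ObjectProperty (ModuleCat.{u} Aᵐᵒᵖ)}
    {P : ModuleCat.{u} Aᵐᵒᵖ} (h : IsSupportingProjective 𝒞 P) {X : ModuleCat.{u} Aᵐᵒᵖ}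
    (hX : 𝒞 X) (hXp : Module.Projective Aᵐᵒᵖ X) :
    ∃ f : P →ₗ[Aᵐᵒᵖ] X, Function.Surjective f := by
  obtain ⟨n, Q, -, hQ, ⟨k⟩⟩ := h
  obtain ⟨i, ⟨j⟩, -⟩ := hQ X hX hXp
  exact ⟨j.toLinearEquiv.symm.toLinearMap ∘ₗ
      LinearMap.proj (R := Aᵐᵒᵖ) (φ := fun i => Q i) i ∘ₗ k.toLinearMap,
    j.toLinearEquiv.symm.surjective.comp
      ((LinearMap.proj_surjective (R := Aᵐᵒᵖ) (φ := fun i => Q i) i).comp k.surjective)⟩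

lemma ClosedUnderPredecessors.prop_of_hom {𝒞 : ObjectProperty (ModuleCat.{u} Aᵐᵒᵖ)}
    (h : ClosedUnderPredecessors 𝒞) (hind : 𝒞 ≤ indMod A) {X Y : ModuleCat.{u} Aᵐᵒᵖ}
    (hX : indMod A X) (hY : 𝒞 Y) (f : X →ₗ[Aᵐᵒᵖ] Y) {x : X} (hx : f x ≠ 0) : 𝒞 X := by
  refine h X Y (.single ⟨hX, hind _ hY, ModuleCat.ofHom f, fun h0 => hx ?_⟩) hY
  exact LinearMap.congr_fun (congrArg ModuleCat.Hom.hom h0) x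

/-- Indecomposable modules in `add(𝒞)` belong to `𝒞`, if `𝒞` is closed under predecessors. -/
lemma ClosedUnderPredecessors.prop_of_addClosure {𝒞 : ObjectProperty (ModuleCat.{u} Aᵐᵒᵖ)}
    (h : ClosedUnderPredecessors 𝒞) (hind : 𝒞 ≤ indMod A) {X : ModuleCat.{u} Aᵐᵒᵖ}
    (hX : indMod A X) (hadd : addClosure 𝒞 X) : 𝒞 X := by
  obtain ⟨n, Y, hY, Z, ⟨k⟩⟩ := hadd
  have hX0 := hX.2.1
  rw [ModuleCat.isZero_iff_subsingleton, not_subsingleton_iff_nontrivial] at hX0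
  obtain ⟨x, hx⟩ := exists_ne (0 : X)
  have : k (x, 0) ≠ 0 := by
    rw [Ne, LinearEquiv.map_eq_zero_iff]
    exact fun h => hx (congrArg Prod.fst h)
  obtain ⟨i, hi⟩ := Function.ne_iff.1 this
  exact h.prop_of_hom hind hX (hY i)
    (LinearMap.proj i ∘ₗ k.toLinearMap ∘ₗ LinearMap.inl Aᵐᵒᵖ X Z) (x := x) hi

/-- An abelian exact subcategory that contains `P = eA` contains the quotients of `P` by finitely
generated submodules fixed by `e`. -/
lemma IsAbelianExact.prop_quotient_rightIdeal {𝒜 : ObjectProperty (ModuleCat.{u} Aᵐᵒᵖ)}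
    [𝒜.IsClosedUnderIsomorphisms] (h : IsAbelianExact 𝒜) {e : A} (he : IsIdempotentElem e)
    (hfix : ∀ a ∈ rightIdeal e, a * e = a)
    (h𝒜 : 𝒜 (ModuleCat.of Aᵐᵒᵖ (rightIdeal e))) {N : Submodule Aᵐᵒᵖ (rightIdeal e)}
    (hN : N.FG) : 𝒜 (ModuleCat.of Aᵐᵒᵖ (rightIdeal e ⧸ N)) := by
  classical
  obtain ⟨s, rfl⟩ := hN
  induction s using Finset.induction_on with
  | empty =>
    rw [Finset.coe_empty, Submodule.span_empty]
    exact 𝒜.prop_of_iso (Submodule.quotEquivOfEqBot _ rfl).symm.toModuleIso h𝒜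
  | insert k s _ ih =>
    let N := Submodule.span Aᵐᵒᵖ (s : Set (rightIdeal e))
    let N' := Submodule.span Aᵐᵒᵖ ((insert k s : Finset _) : Set (rightIdeal e))
    have hN' : N' = Submodule.span Aᵐᵒᵖ {k} ⊔ N := by
      simp only [N', N, Finset.coe_insert, Submodule.span_insert]
    have hle : N ≤ N' := hN' ▸ le_sup_right
    -- Since `ke = k`, left multiplication by `k` maps `eA` onto `kA`, so the induced map `eA →
    -- eA/N` has cokernel `eA/(kA + N)`.
    refine h.prop_of_surjective h𝒜 ih (N.mkQ ∘ₗ evalAt k ∘ₗ (rightIdeal e).subtype)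
      (Submodule.factor hle) (Submodule.factor_surjective hle) ?_
    apply le_antisymm
    · intro x hx
      obtain ⟨x, rfl⟩ := N.mkQ_surjective x
      have hx' : x ∈ N' := (Submodule.Quotient.mk_eq_zero _).1 hx
      rw [hN', Submodule.mem_sup] at hx'
      obtain ⟨a, ha, b, hb, rfl⟩ := hx'
      obtain ⟨r, rfl⟩ := Submodule.mem_span_singleton.1 ha
      refine ⟨⟨e * r.unop, (mem_rightIdeal he).2 (by rw [← mul_assoc, he.eq])⟩, ?_⟩
      have h1 : op (e * r.unop) • k = r • k := by
        apply Subtype.ext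
        change k.1 * (e * r.unop) = k.1 * r.unop
        rw [← mul_assoc, hfix _ k.2]
      change N.mkQ (op (e * r.unop) • k) = N.mkQ (r • k + b)
      rw [h1, map_add, show N.mkQ b = 0 from (Submodule.Quotient.mk_eq_zero N).2 hb,
        add_zero]
    · rintro _ ⟨a, rfl⟩
      refine (Submodule.Quotient.mk_eq_zero _).2 ?_
      change op a.1 • k ∈ N'
      rw [hN']
      exact Submodule.mem_sup_left
        (Submodule.smul_mem _ _ (Submodule.mem_span_singleton_self k))

/-- Let `eA(1-e) = 0`. If `add(𝒞)` is abelian exact for a class `𝒞` closed under predecessors with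
supporting projective `eA`, then every indecomposable module is fixed by `e` or generated by
`1 - e`. -/
lemma ClosedUnderPredecessors.fixed_or_traceSubmodule_eq_top [IsNoetherianRing Aᵐᵒᵖ]
    {𝒞 : ObjectProperty (ModuleCat.{u} Aᵐᵒᵖ)} (h : ClosedUnderPredecessors 𝒞)
    (hind : 𝒞 ≤ indMod A) (hab : IsAbelianExact (addClosure 𝒞)) {e : A}
    (he : IsIdempotentElem e) (htri : ∀ a, e * a * (1 - e) = 0)
    (hsupp : IsSupportingProjective 𝒞 (ModuleCat.of Aᵐᵒᵖ (rightIdeal e)))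
    {κ : Type*} [Fintype κ] (f : κ → A) (hf : ∀ y, IsPrimitiveIdem (f y))
    (hfe : ∀ y, f y * e = 0) (hsum : ∑ y, f y = 1 - e) (Y : ModuleCat.{u} Aᵐᵒᵖ)
    (hY : indMod A Y) :
    (∀ y : Y, op e • y = y) ∨ traceSubmodule (1 - e) Y = ⊤ := by
  have hfix : ∀ a ∈ rightIdeal e, a * e = a := by
    intro a ha
    have := htri a
    rw [(mem_rightIdeal he).1 ha, mul_sub, mul_one, sub_eq_zero] at this
    exact this.symm
  have fixed : ∀ X, 𝒞 X → ∀ x : X, op e • x = x := by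
    intro X hX x
    by_contra hne
    have h1 : op (1 - e) • x ≠ 0 := by
      rw [MulOpposite.op_sub, sub_smul, MulOpposite.op_one, one_smul, Ne, sub_eq_zero]
      exact fun h => hne h.symm
    rw [← hsum, ← evalAt_apply, map_sum] at h1
    obtain ⟨y, -, hy⟩ := Finset.exists_ne_zero_of_sum_ne_zero h1
    let g : rightIdeal (f y) := ⟨f y, Submodule.mem_span_singleton_self _⟩
    -- A nonzero map to `X` puts `f_y A` in `𝒞`; being projective, it is then a quotient of `eA`,
    -- hence fixed by `e`, against `f_y e = 0`.
    have hP : 𝒞 (ModuleCat.of Aᵐᵒᵖ (rightIdeal (f y))) :=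
      h.prop_of_hom hind (hf y).indMod_rightIdeal hX
        (evalAt x ∘ₗ (rightIdeal (f y)).subtype) (x := g) hy
    obtain ⟨p, hp⟩ := hsupp.exists_surjective hP (projective_rightIdeal (hf y).2.1)
    obtain ⟨a, ha⟩ := hp g
    have h2 : op e • a = a := Subtype.ext (hfix _ a.2)
    have h3 : op e • g = g := by rw [← ha, ← map_smul, h2]
    have h4 : f y * e = f y := congrArg Subtype.val h3
    exact (hf y).1 (by rw [← h4, hfe])
  by_cases htop : traceSubmodule (1 - e) Y = ⊤
  · exact Or.inr htop
  refine Or.inl (fixed Y ?_)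
  have := hY.1
  -- A maximal submodule containing the trace gives a simple quotient killed by `1 - e`, hence a
  -- quotient of `eA`.
  obtain ⟨K, hK, hle⟩ := (eq_top_or_exists_le_coatom (traceSubmodule (1 - e) Y)).resolve_left htop
  let S := ModuleCat.of Aᵐᵒᵖ (Y ⧸ K)
  have hS : IsSimpleModule Aᵐᵒᵖ S := isSimpleModule_iff_isCoatom.2 hK
  have : Nontrivial S := IsSimpleModule.nontrivial Aᵐᵒᵖ S
  have : Module.Finite Aᵐᵒᵖ S := inferInstanceAs (Module.Finite Aᵐᵒᵖ (Y ⧸ K))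
  have hSind : indMod A S := indMod_of_forall_isCompl S fun U W hUW => by
    rcases eq_bot_or_eq_top U with hU | hU
    · exact Or.inl hU
    · subst hU
      right
      simpa using hUW.inf_eq_bot
  obtain ⟨s, hs⟩ := exists_ne (0 : S)
  obtain ⟨y, rfl⟩ := K.mkQ_surjective s
  refine h.prop_of_hom hind hY (h.prop_of_addClosure hind hSind ?_) K.mkQ (x := y) hs
  let r : rightIdeal e →ₗ[Aᵐᵒᵖ] S := evalAt (K.mkQ y) ∘ₗ (rightIdeal e).subtype
  have hse : op e • K.mkQ y = K.mkQ y := by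
    have h1 : K.mkQ (op (1 - e) • y) = 0 :=
      (Submodule.Quotient.mk_eq_zero K).2 (hle (op_smul_mem_traceSubmodule _ y))
    rw [map_smul, MulOpposite.op_sub, sub_smul, MulOpposite.op_one, one_smul, sub_eq_zero] at h1
    exact h1.symm
  have hr : Function.Surjective r := by
    rw [← LinearMap.range_eq_top]
    refine (eq_bot_or_eq_top (LinearMap.range r)).resolve_left fun h0 => hs ?_
    rw [← hse]
    exact LinearMap.congr_fun (LinearMap.range_eq_bot.1 h0)
      ⟨e, Submodule.mem_span_singleton_self e⟩
  have : Module.Finite Aᵐᵒᵖ (rightIdeal e) := Module.Finite.span_singleton Aᵐᵒᵖ e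
  exact (addClosure 𝒞).prop_of_iso (r.quotKerEquivOfSurjective hr).toModuleIso
    (hab.prop_quotient_rightIdeal he hfix hsupp.addClosure (IsNoetherian.noetherian _))

end Predecessors

/-! ## Arrows into the corner `eAe` -/

section Arrows

variable {A : Type u} [Ring A]

/-- Let `eA(1-e) = 0` and suppose that every indecomposable module is fixed by `e` or generated by
`1 - e`. If `e_x` is a primitive idempotent in `eAe`, then `(1-e)Je_x ∖ J²` and `eJe_x ∖ J²` are
not both nonempty. -/
lemma mem_jacobson_mul_jacobson_of_indMod [IsArtinianRing Aᵐᵒᵖ] {e : A}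
    (he : IsIdempotentElem e) (htri : ∀ a, e * a * (1 - e) = 0)
    (hrad : ∀ a, (1 - e) * a * e ∈ Ring.jacobson A)
    (H : ∀ Y, indMod A Y → (∀ y : Y, op e • y = y) ∨ traceSubmodule (1 - e) Y = ⊤)
    {ex : A} (hex : IsPrimitiveIdem ex)
    {m : A} (hmJ : m ∈ Ring.jacobson A) (hm : e * m = 0) (hmx : m * ex = m)
    {w : A} (hwJ : w ∈ Ring.jacobson A) (hw : e * w = w) (hwx : w * ex = w)
    (hwJ2 : w ∉ Ring.jacobson A * Ring.jacobson A) :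
    m ∈ Ring.jacobson A * Ring.jacobson A := by
  -- Dividing by `J²` makes `J` kill the class of `m`, and dividing by `eA` makes the quotient
  -- generated by `1 - e`. Both are needed for the two extension results.
  let K : Submodule Aᵐᵒᵖ A := (Ring.jacobson A * Ring.jacobson A).toRightSubmodule ⊔ rightIdeal e
  have hle : ∀ {a}, a ∈ Ring.jacobson A * Ring.jacobson A → K.mkQ a = 0 := fun ha =>
    (Submodule.Quotient.mk_eq_zero K).2 (Submodule.mem_sup_left ha)
  have hle' : ∀ {a}, e * a = a → K.mkQ a = 0 := fun ha =>
    (Submodule.Quotient.mk_eq_zero K).2 (Submodule.mem_sup_right ((mem_rightIdeal he).2 ha))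
  have finA : Module.Finite Aᵐᵒᵖ A :=
    Module.Finite.of_surjective (LinearMap.toSpanSingleton Aᵐᵒᵖ A 1) fun a => ⟨op a, one_mul a⟩
  have finE : Module.Finite Aᵐᵒᵖ (rightIdeal e) := Module.Finite.span_singleton Aᵐᵒᵖ e
  obtain ⟨f, hf⟩ := hex.exists_linearMap_jacobson (V := A ⧸ K) hwJ hwJ2 hwx (s := K.mkQ m)
    (by rw [← map_smul]; exact congrArg _ hmx)
    (fun r hr => by rw [← map_smul]; exact hle (Ideal.mul_mem_mul hmJ hr))
  let I : Submodule Aᵐᵒᵖ (rightIdeal e) :=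
    (Ring.jacobson A).toRightSubmodule.comap (rightIdeal e).subtype
  let i : I →ₗ[Aᵐᵒᵖ] (Ring.jacobson A).toRightSubmodule :=
    ((rightIdeal e).subtype ∘ₗ I.subtype).codRestrict _ fun x => x.2
  obtain ⟨g, hg⟩ := exists_extension_of_indMod e H (P := rightIdeal e) (V := A ⧸ K)
    (fun p => by
      apply Subtype.ext
      have := htri p.1
      rw [(mem_rightIdeal he).1 p.2, mul_sub, mul_one, sub_eq_zero] at this
      exact this.symm)
    (by
      refine eq_top_iff.2 fun x _ => ?_
      obtain ⟨a, rfl⟩ := K.mkQ_surjective x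
      have h1 : K.mkQ a = op a • op (1 - e) • K.mkQ 1 := by
        rw [← map_smul, ← map_smul, ← sub_eq_zero, ← map_sub]
        refine hle' ?_
        change e * (a - 1 * (1 - e) * a) = a - 1 * (1 - e) * a
        rw [one_mul, sub_mul, one_mul, sub_sub_cancel, ← mul_assoc, he.eq]
      rw [h1]
      exact Submodule.smul_mem _ _ (op_smul_mem_traceSubmodule _ _))
    I (f ∘ₗ i)
  let w' : rightIdeal e := ⟨w, (mem_rightIdeal he).2 hw⟩
  let e' : rightIdeal e := ⟨e, Submodule.mem_span_singleton_self e⟩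
  have hgw : g w' = K.mkQ m := (hg ⟨w', hwJ⟩).trans hf
  have hwe : w' = op w • e' := Subtype.ext hw.symm
  obtain ⟨a, ha⟩ := K.mkQ_surjective (g e')
  have hm0 : K.mkQ m = 0 := by
    rw [← hgw, hwe, map_smul, ← ha, ← map_smul]
    change K.mkQ (a * w) = 0
    -- From `w = ew`, the image of `w` is the class of `aw`. The first term is in `eA`, and the
    -- second in `J²` because `(1 - e)Ae` lies in `J`.
    have : a * w = e * (a * w) + (1 - e) * a * e * w := by
      rw [mul_assoc _ e w, hw]; noncomm_ring
    rw [this, map_add, hle (Ideal.mul_mem_mul (hrad a) hwJ),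
      hle' (by rw [← mul_assoc, he.eq]), add_zero]
  -- Multiplying `m = b + c` by `1 - e` on the left removes the part `c` in `eA` and leaves `m`
  -- unchanged, as `em = 0`.
  obtain ⟨b, hb, c, hc, hbc⟩ := Submodule.mem_sup.1 ((Submodule.Quotient.mk_eq_zero K).1 hm0)
  have hc' := (mem_rightIdeal he).1 hc
  have : m = (1 - e) * b := by
    rw [← sub_eq_iff_eq_add.2 hbc.symm, sub_mul, mul_sub, mul_sub, one_mul, one_mul, hm, hc']
    abel
  rw [this]
  exact Ideal.mul_mem_left _ _ hb

/-- If `M` is hereditary injective and `e_x` is a primitive idempotent, then a submodule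
`N ⊇ MJ` contains `Me_x` or `Je_x ⊆ J²`. -/
lemma IsHereditaryInjective.mem_of_notMem [IsArtinianRing Aᵐᵒᵖ] {M : Type u} [AddCommGroup M]
    [Module Aᵐᵒᵖ M] (hM : IsHereditaryInjective A M) {ex : A} (hex : IsPrimitiveIdem ex)
    {N : Submodule Aᵐᵒᵖ M} (hN : ∀ r ∈ Ring.jacobson A, ∀ n : M, op r • n ∈ N)
    {m : M} (hm : op ex • m = m) {w : A} (hwJ : w ∈ Ring.jacobson A) (hwx : w * ex = w)
    (hwJ2 : w ∉ Ring.jacobson A * Ring.jacobson A) : m ∈ N := by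
  have hN' : ∀ r ∈ Ring.jacobson A, ∀ v : M ⧸ N, op r • v = 0 := by
    intro r hr v
    obtain ⟨v, rfl⟩ := N.mkQ_surjective v
    rw [← map_smul]
    exact (Submodule.Quotient.mk_eq_zero N).2 (hN r hr v)
  obtain ⟨f, hf⟩ := hex.exists_linearMap_jacobson (V := M ⧸ N) hwJ hwJ2 hwx (s := N.mkQ m)
    (by rw [← map_smul, hm]) (fun r hr => hN' r hr _)
  have := hM N
  -- Extending from the radical to the whole ring allows writing `w = 1 · w`, whose image is a
  -- radical multiple in `M/N`, hence zero.
  obtain ⟨g, hg⟩ := Module.Injective.out (Q := M ⧸ N) (R := Aᵐᵒᵖ)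
    (Ring.jacobson A).toRightSubmodule.subtype (Submodule.injective_subtype _) f
  rw [← Submodule.Quotient.mk_eq_zero]
  change N.mkQ m = 0
  rw [← hf, ← hg]
  have h1 : (Ring.jacobson A).toRightSubmodule.subtype ⟨w, hwJ⟩ = op w • (1 : A) :=
    (one_mul w).symm
  rw [h1, map_smul, hN' w hwJ]

end Arrows

/-! ## Triangular matrix rings -/

lemma IsPrimitiveIdem.map_ringEquiv {A B : Type u} [Ring A] [Ring B] (φ : A ≃+* B) {e : A}
    (he : IsPrimitiveIdem e) : IsPrimitiveIdem (φ e) := by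
  obtain ⟨h0, hi, h⟩ := he
  refine ⟨by simpa using h0, by rw [IsIdempotentElem, ← map_mul, hi.eq],
    fun f g hf hg hfg hgf hs => ?_⟩
  have := h (φ.symm f) (φ.symm g) (by rw [IsIdempotentElem, ← map_mul, hf.eq])
    (by rw [IsIdempotentElem, ← map_mul, hg.eq]) (by rw [← map_mul, hfg, map_zero])
    (by rw [← map_mul, hgf, map_zero]) (by rw [← map_add, hs, φ.symm_apply_apply])
  simpa using this

lemma IsIdempotentElem.eq_zero_of_add_eq_zero {A : Type u} [Ring A] {f g : A}
    (hf : IsIdempotentElem f) (hfg : f * g = 0) (h : f + g = 0) : f = 0 := by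
  rw [← hf.eq]
  nth_rewrite 2 [eq_neg_of_add_eq_zero_left h]
  rw [mul_neg, hfg, neg_zero]

lemma map_mem_jacobson {A B : Type u} [Ring A] [Ring B] (φ : A →+* B)
    (hφ : Function.Surjective φ) {x : A} (hx : x ∈ Ring.jacobson A) : φ x ∈ Ring.jacobson B :=
  have : RingHomSurjective φ := ⟨hφ⟩
  Ring.le_comap_jacobson φ hx

lemma map_mem_jacobson_mul_jacobson {A B : Type u} [Ring A] [Ring B] (φ : A →+* B)
    (hφ : Function.Surjective φ) {x : A} (hx : x ∈ Ring.jacobson A * Ring.jacobson A) :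
    φ x ∈ Ring.jacobson B * Ring.jacobson B := by
  suffices Ring.jacobson A * Ring.jacobson A ≤ (Ring.jacobson B * Ring.jacobson B).comap φ from
    this hx
  refine Ideal.mul_le.2 fun a ha b hb => ?_
  rw [Ideal.mem_comap, map_mul]
  exact Ideal.mul_mem_mul (map_mem_jacobson φ hφ ha) (map_mem_jacobson φ hφ hb)

namespace TriMatrix

variable {C M B : Type u} [Ring C] [Ring B] [AddCommGroup M] [Module B M] [Module Cᵐᵒᵖ M]

lemma eq_zero_of_isIdempotentElem {t : TriMatrix C M B} (ht : IsIdempotentElem t)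
    (hc : t.c = 0) (hb : t.b = 0) : t = 0 := by
  rw [← ht.eq]
  ext <;> simp [hc, hb]

lemma ofB_mul_mul_ofC (b : B) (t : TriMatrix C M B) (c : C) :
    ofB C M b * t * ofC M B c = ⟨0, op c • b • t.m, 0⟩ := by
  ext <;> simp [ofB, ofC]

variable [SMulCommClass B Cᵐᵒᵖ M]

lemma toC_surjective : Function.Surjective (toC C M B) := fun c => ⟨ofC M B c, rfl⟩

/-- The lower right entries of two orthogonal idempotents with sum `(c 0; 0 0)` are orthogonal
idempotents with sum zero, so they vanish. Primitivity of `c` kills one upper left entry, and an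
idempotent with zero diagonal is zero. -/
lemma isPrimitiveIdem_ofC {c : C} (hc : IsPrimitiveIdem c) : IsPrimitiveIdem (ofC M B c) := by
  obtain ⟨h0, hi, h⟩ := hc
  refine ⟨fun h' => h0 (congrArg TriMatrix.c h'), ?_, fun f g hf hg hfg hgf hs => ?_⟩
  · ext <;> simp [ofC, hi.eq]
  have hb : f.b + g.b = 0 := congrArg TriMatrix.b hs
  have hfb : f.b = 0 := IsIdempotentElem.eq_zero_of_add_eq_zero
    (congrArg TriMatrix.b hf) (congrArg TriMatrix.b hfg) hb
  have hgb : g.b = 0 := by rwa [hfb, zero_add] at hb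
  exact (h f.c g.c (congrArg TriMatrix.c hf) (congrArg TriMatrix.c hg) (congrArg TriMatrix.c hfg)
    (congrArg TriMatrix.c hgf) (congrArg TriMatrix.c hs)).imp
    (fun h' => eq_zero_of_isIdempotentElem hf h' hfb)
    (fun h' => eq_zero_of_isIdempotentElem hg h' hgb)

lemma isPrimitiveIdem_ofB {b : B} (hb : IsPrimitiveIdem b) : IsPrimitiveIdem (ofB C M b) := by
  obtain ⟨h0, hi, h⟩ := hb
  refine ⟨fun h' => h0 (congrArg TriMatrix.b h'), ?_, fun f g hf hg hfg hgf hs => ?_⟩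
  · ext <;> simp [ofB, hi.eq]
  have hc : f.c + g.c = 0 := congrArg TriMatrix.c hs
  have hfc : f.c = 0 := IsIdempotentElem.eq_zero_of_add_eq_zero
    (congrArg TriMatrix.c hf) (congrArg TriMatrix.c hfg) hc
  have hgc : g.c = 0 := by rwa [hfc, zero_add] at hc
  exact (h f.b g.b (congrArg TriMatrix.b hf) (congrArg TriMatrix.b hg) (congrArg TriMatrix.b hfg)
    (congrArg TriMatrix.b hgf) (congrArg TriMatrix.b hs)).imp
    (fun h' => eq_zero_of_isIdempotentElem hf hfc h')
    (fun h' => eq_zero_of_isIdempotentElem hg hgc h')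

lemma isNilpotent_of_c {t : TriMatrix C M B} (hb : t.b = 0) (hc : IsNilpotent t.c) :
    IsNilpotent t := by
  obtain ⟨n, hn⟩ := hc
  -- The lower left entry of the power lags by one factor `c`, hence the exponent `n + 1` when `c ^
  -- n = 0`.
  have key : ∀ n : ℕ, t ^ (n + 1) = ⟨t.c ^ (n + 1), op (t.c ^ n) • t.m, 0⟩ := by
    intro n
    induction n with
    | zero => ext <;> simp [hb]
    | succ n ih =>
      rw [pow_succ, ih]
      ext
      · simp [pow_succ]
      · simp only [mul_m, zero_smul, add_zero, ← mul_smul, ← op_mul, pow_succ]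
      · simp
  refine ⟨n + 1, ?_⟩
  rw [key, pow_succ, hn]
  ext <;> simp

/-- A matrix with first column in the radical of `C` and in `M`, and second column zero, lies in
the radical. -/
lemma mem_jacobson_of_c [IsArtinianRing C] {t : TriMatrix C M B} (hb : t.b = 0)
    (hc : t.c ∈ Ring.jacobson C) : t ∈ Ring.jacobson (TriMatrix C M B) :=
  mem_jacobson_of_forall_isNilpotent fun y => isNilpotent_of_c (by simp [hb])
    (isNilpotent_of_mem_jacobson (Ideal.mul_mem_left _ y.c hc))

lemma ofC_mul_mul_one_sub (t : TriMatrix C M B) :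
    ofC M B 1 * t * (1 - ofC M B 1) = 0 := by
  ext <;> simp [ofC, sub_eq_add_neg]

end TriMatrix

/-- Under the first and the third condition, every indecomposable module is fixed by `e`
or generated by `1 - e`. -/
lemma fixed_or_traceSubmodule_cornerIdem_eq_top
    {A C M B : Type u} [Ring A] [IsNoetherianRing Aᵐᵒᵖ] [Ring C] [Ring B] [AddCommGroup M]
    [Module B M] [Module Cᵐᵒᵖ M] [SMulCommClass B Cᵐᵒᵖ M] (φ : A ≃+* TriMatrix C M B)
    {𝒞 : ObjectProperty (ModuleCat.{u} Aᵐᵒᵖ)} (hind : 𝒞 ≤ indMod A)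
    (hcond : PredecessorCondition φ 𝒞 ∨ IdempotentCondition φ 𝒞)
    (he : IsIdempotentElem (cornerIdem φ))
    (htri : ∀ a, cornerIdem φ * a * (1 - cornerIdem φ) = 0)
    {κ : Type*} [Fintype κ] {eB : κ → B} (hB : IsCompletePrimitive eB)
    (Y : ModuleCat.{u} Aᵐᵒᵖ) (hY : indMod A Y) :
    (∀ y : Y, op (cornerIdem φ) • y = y) ∨ traceSubmodule (1 - cornerIdem φ) Y = ⊤ := by
  rcases hcond with ⟨h1, h2, h3⟩ | ⟨-, h2, h3⟩
  · refine h1.fixed_or_traceSubmodule_eq_top hind h2 he htri h3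
      (fun y => φ.symm (TriMatrix.ofB C M (eB y)))
      (fun y => (TriMatrix.isPrimitiveIdem_ofB (hB.2 y)).map_ringEquiv φ.symm)
      (fun y => ?_) ?_ Y hY
    · rw [cornerIdem, ← map_mul, map_eq_zero_iff _ φ.symm.injective]
      ext <;> simp [TriMatrix.ofB, TriMatrix.ofC]
    · let β : B →+ TriMatrix C M B :=
        { toFun := TriMatrix.ofB C M
          map_zero' := rfl
          map_add' := fun a b => by ext <;> simp [TriMatrix.ofB] }
      have hsum : ∑ y, TriMatrix.ofB C M (eB y) = 1 - TriMatrix.ofC M B 1 := by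
        change ∑ y, β (eB y) = _
        rw [← map_sum, hB.1.complete]
        change TriMatrix.ofB C M 1 = _
        ext <;> simp [TriMatrix.ofB, TriMatrix.ofC, sub_eq_add_neg]
      rw [← map_sum, hsum, map_sub, map_one]
      rfl
  · by_cases hYC : 𝒞 Y
    · exact Or.inl ((h2 Y).1 hYC).2
    · exact Or.inr (traceSubmodule_eq_top_of_genBy he.one_sub (h3 Y hY hYC))

theorem mainTheorem7
    {R : Type v} {A C M B : Type u} [CommRing R] [IsArtinianRing R]
    [Ring A] [Algebra R A] [Module.Finite R A]
    (hbasic : IsBasicRing A) (hconn : IsConnectedRing A)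
    [Ring C] [Ring B] [AddCommGroup M] [Module B M] [Module Cᵐᵒᵖ M] [SMulCommClass B Cᵐᵒᵖ M]
    (φ : A ≃+* TriMatrix C M B)
    (𝒞 : ObjectProperty (ModuleCat.{u} Aᵐᵒᵖ)) [𝒞.IsClosedUnderIsomorphisms]
    (hind : 𝒞 ≤ indMod A)
    (hcond : PredecessorCondition φ 𝒞 ∨ MatrixCondition φ 𝒞 ∨ IdempotentCondition φ 𝒞)
    {ι κ : Type*} [Fintype ι] [Fintype κ] (eC : ι → C) (eB : κ → B)
    (hC : IsCompletePrimitive eC) (hB : IsCompletePrimitive eB)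
    (y : κ) (x : ι)
    (harrow : (ringQuiver (triPoints φ eC eB)).Adj (Sum.inr y) (Sum.inl x)) :
    IsSourcePoint (ringQuiver eC) x := by
  have : IsArtinianRing A := IsArtinianRing.of_finite R A
  have : IsArtinianRing Aᵐᵒᵖ := IsArtinianRing.of_finite R Aᵐᵒᵖ
  let p : A →+* C := (TriMatrix.toC C M B).comp φ.toRingHom
  have hp : Function.Surjective p := TriMatrix.toC_surjective.comp φ.surjective
  have : IsArtinianRing C := hp.isArtinianRing
  have hpop : Function.Surjective p.op := fun c => by
    obtain ⟨a, ha⟩ := hp c.unop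
    exact ⟨op a, congrArg op ha⟩
  have : IsArtinianRing Cᵐᵒᵖ := hpop.isArtinianRing
  have hJ {t : TriMatrix C M B} (hb : t.b = 0) (hc : t.c ∈ Ring.jacobson C) :
      φ.symm t ∈ Ring.jacobson A :=
    map_mem_jacobson φ.symm.toRingHom φ.symm.surjective (TriMatrix.mem_jacobson_of_c hb hc)
  have he : IsIdempotentElem (cornerIdem φ) := by
    rw [IsIdempotentElem, cornerIdem, ← map_mul]
    congr 1
    ext <;> simp [TriMatrix.ofC]
  have htri : ∀ a, cornerIdem φ * a * (1 - cornerIdem φ) = 0 := fun a => by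
    obtain ⟨t, rfl⟩ := φ.symm.surjective a
    rw [cornerIdem, ← map_one φ.symm, ← map_sub, ← map_mul, ← map_mul,
      TriMatrix.ofC_mul_mul_one_sub, map_zero]
  rintro z ⟨c, hc, hcJ⟩
  obtain ⟨a, ha, haJ⟩ := harrow
  refine haJ ?_
  obtain ⟨t, rfl⟩ := φ.symm.surjective a
  have hex := hC.2 x
  change φ.symm (TriMatrix.ofB C M (eB y)) * φ.symm t * φ.symm (TriMatrix.ofC M B (eC x)) ∈ _
  rw [← map_mul, ← map_mul, TriMatrix.ofB_mul_mul_ofC]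
  let n := op (eC x) • eB y • t.m
  have hn : op (eC x) • n = n := by
    rw [← mul_smul, ← op_mul, hex.2.1.eq]
  let w := eC z * c * eC x
  have hwJ : w ∈ Ring.jacobson C := Ideal.mul_mem_right _ _ (Ideal.mul_mem_left _ _ hc)
  have hwx : w * eC x = w := by rw [mul_assoc, hex.2.1.eq]
  -- The first and third conditions act only through the dichotomy for indecomposables; the second
  -- only through injectivity of the quotients of `M`.
  suffices (PredecessorCondition φ 𝒞 ∨ IdempotentCondition φ 𝒞) ∨ IsHereditaryInjective C M by
    rcases this with h | h
    · refine mem_jacobson_mul_jacobson_of_indMod he htri (fun a => ?_)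
        (fixed_or_traceSubmodule_cornerIdem_eq_top φ hind h he htri hB)
        ((TriMatrix.isPrimitiveIdem_ofC hex).map_ringEquiv φ.symm)
        (hJ rfl (Submodule.zero_mem _)) ?_ ?_ (w := φ.symm (TriMatrix.ofC M B w))
        (hJ rfl hwJ) ?_ ?_ fun h' => hcJ ?_
      · obtain ⟨t, rfl⟩ := φ.symm.surjective a
        rw [cornerIdem, ← map_one φ.symm, ← map_sub, ← map_mul, ← map_mul]
        refine hJ ?_ ?_
        · simp [TriMatrix.ofC]
        · simp [TriMatrix.ofC, sub_eq_add_neg]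
      · rw [cornerIdem, ← map_mul, map_eq_zero_iff _ φ.symm.injective]
        ext <;> simp [TriMatrix.ofC]
      · rw [← map_mul]
        congr 1
        ext
        · simp [TriMatrix.ofC]
        · simpa [TriMatrix.ofC] using hn
        · simp [TriMatrix.ofC]
      · rw [cornerIdem, ← map_mul]
        congr 1
        ext <;> simp [TriMatrix.ofC]
      · rw [← map_mul]
        congr 1
        ext
        · exact hwx
        · simp [TriMatrix.ofC]
        · simp [TriMatrix.ofC]
      -- The projection to `C` carries `J(A)²` into `J(C)²`, so `w` stays outside the square of the
      -- radical when viewed in `A`.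
      · have := map_mem_jacobson_mul_jacobson p hp h'
        change (φ (φ.symm (TriMatrix.ofC M B w))).c ∈ _ at this
        rwa [φ.apply_symm_apply] at this
    -- `N` is the part of `M` inside `J(A)²`. It contains `M J(C)`, since both `M` and `J(C)` lie in
    -- `J(A)`.
    · let N : Submodule Cᵐᵒᵖ M :=
        { carrier := {m | φ.symm ⟨0, m, 0⟩ ∈ Ring.jacobson A * Ring.jacobson A}
          zero_mem' := by
            rw [Set.mem_ofPred_eq, show (⟨0, 0, 0⟩ : TriMatrix C M B) = 0 from rfl, map_zero]
            exact Submodule.zero_mem _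
          add_mem' := fun {a b} ha hb => by
            rw [Set.mem_ofPred_eq] at ha hb ⊢
            have := Ideal.add_mem _ ha hb
            rw [← map_add] at this
            convert this using 2
            ext <;> simp
          smul_mem' := fun r a ha => by
            rw [Set.mem_ofPred_eq] at ha ⊢
            have := Ideal.mul_mem_right (φ.symm (TriMatrix.ofC M B r.unop)) _ ha
            rw [← map_mul] at this
            convert this using 2
            ext <;> simp [TriMatrix.ofC] }
      have hN (m : M) : m ∈ N ↔ φ.symm ⟨0, m, 0⟩ ∈ Ring.jacobson A * Ring.jacobson A :=
        Set.mem_ofPred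
      refine (hN n).1 (h.mem_of_notMem hex (fun r hr m => (hN _).2 ?_) hn hwJ hwx hcJ)
      have := Ideal.mul_mem_mul (hJ (t := ⟨0, m, 0⟩) rfl (Submodule.zero_mem _))
        (hJ (t := TriMatrix.ofC M B r) rfl hr)
      rw [← map_mul] at this
      convert this using 2
      ext <;> simp [TriMatrix.ofC]
  exact hcond.elim (fun h => Or.inl (Or.inl h)) fun h =>
    h.elim (fun h => Or.inr h.1) fun h => Or.inl (Or.inr h)
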